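/- For $\nu>-1$ and $x>0$ let $$\mathbf{L}_\nu(x)=\sum_{k=0}^\infty\frac{(\frac12x)^{\nu+2k+1}}{\Gamma(k+\frac32)\,\Gamma(k+\nu+\frac32)}$$ be the modified Struve function of the first kind, and for $a>0$ let $\gamma(a,x)=\int_0^x \mathrm{e}^{-t}t^{a-1}\,\mathrm{d}t$ be the lower incomplete gamma function. Let $0<\beta<1$. For all $\nu>-1$ and $x>0$ the integral $$F_\nu(x)=\int_0^x \mathrm{e}^{-\beta t}t^{\nu}\mathbf{L}_\nu(t)\,\mathrm{d}t$$ and the series in (3) below converge. Moreover, for all $x>0$, $$F_\nu(x)>\frac{1}{1-\beta}\bigg\{\mathrm{e}^{-\beta x}x^\nu\mathbf{L}_\nu(x)-\frac{\gamma(2\nu+1,\beta x)}{\sqrt{\pi}\,2^\nu\beta^{2\nu+1}\Gamma(\nu+\frac32)}\bigg\},\qquad -\tfrac12<\nu\le 0,\tag{1}$$ $$F_\nu(x)>\frac{1}{1-\beta}\bigg\{\bigg(1-\frac{4\nu^2}{(2\nu-1)(1-\beta)}\frac1x\bigg)\mathrm{e}^{-\beta x}x^\nu\mathbf{L}_\nu(x)-\frac{\gamma(2\nu+1,\beta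 x)}{\sqrt{\pi}\,2^\nu\beta^{2\nu+1}\Gamma(\nu+\frac32)}\bigg\},\qquad \nu\ge\tfrac32,\tag{2}$$ $$F_\nu(x)>\mathrm{e}^{-\beta x}x^\nu\sum_{k=0}^\infty\beta^k\,\mathbf{L}_{\nu+k+1}(x),\qquad \nu>-1.\tag{3}$$ Each of the three bounds is tight as $x\to\infty$: for every fixed $\nu$ in the stated range, the ratio of the right-hand side to $F_\nu(x)$ tends to $1$ as $x\to\infty$. -/

import Mathlib

open MeasureTheory Filter Topology

noncomputable section

/-- The modified Struve function of the first kind,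
`𝐋_ν(x) = ∑_{k ≥ 0} (x/2)^(ν+2k+1) / (Γ(k+3/2) Γ(k+ν+3/2))`.
At a pole of the Gamma function the convention `Real.Gamma (-n) = 0`, `y / 0 = 0` agrees with
the usual `1/Γ(-n) = 0`. -/
def struveL (ν x : ℝ) : ℝ :=
  ∑' k : ℕ, (x / 2) ^ (ν + 2 * (k : ℝ) + 1) /
    (Real.Gamma ((k : ℝ) + 3 / 2) * Real.Gamma ((k : ℝ) + ν + 3 / 2))

/-- The lower incomplete gamma function `γ(a, x) = ∫_0^x e^{-t} t^{a-1} dt`. -/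
def lowerGamma (a x : ℝ) : ℝ :=
  ∫ t in (0 : ℝ)..x, Real.exp (-t) * t ^ (a - 1)

/-- The integral `F(x) = ∫_0^x e^{-βt} t^ν 𝐋_ν(t) dt`. -/
def struveIntegral (β ν x : ℝ) : ℝ :=
  ∫ t in (0 : ℝ)..x, Real.exp (-(β * t)) * t ^ ν * struveL ν t

/-- The first lower bound,
`(1/(1-β)) { e^{-βx} x^ν 𝐋_ν(x) - γ(2ν+1, βx) / (√π 2^ν β^{2ν+1} Γ(ν+3/2)) }`. -/
def lowerBound₁ (β ν x : ℝ) : ℝ :=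
  1 / (1 - β) *
    (Real.exp (-(β * x)) * x ^ ν * struveL ν x -
      lowerGamma (2 * ν + 1) (β * x) /
        (√Real.pi * (2 : ℝ) ^ ν * β ^ (2 * ν + 1) * Real.Gamma (ν + 3 / 2)))

/-- The second lower bound: the first one with the factor
`1 - 4ν²/((2ν-1)(1-β)) · 1/x` in front of `e^{-βx} x^ν 𝐋_ν(x)`. -/
def lowerBound₂ (β ν x : ℝ) : ℝ :=
  1 / (1 - β) *
    ((1 - 4 * ν ^ 2 / ((2 * ν - 1) * (1 - β)) * (1 / x)) *
        (Real.exp (-(β * x)) * x ^ ν * struveL ν x) -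
      lowerGamma (2 * ν + 1) (β * x) /
        (√Real.pi * (2 : ℝ) ^ ν * β ^ (2 * ν + 1) * Real.Gamma (ν + 3 / 2)))

/-- The third lower bound, `e^{-βx} x^ν ∑_{k ≥ 0} β^k 𝐋_{ν+k+1}(x)`. -/
def lowerBound₃ (β ν x : ℝ) : ℝ :=
  Real.exp (-(β * x)) * x ^ ν * ∑' k : ℕ, β ^ k * struveL (ν + (k : ℝ) + 1) x

end

/-!
All estimates come from the two first-order relations
`𝐋_ν' = 𝐋_{ν+1} + (ν/x) 𝐋_ν + a_ν x^ν` (`hasDerivAt_struveL`) and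
`𝐋_{ν+1}' = 𝐋_ν - ((ν+1)/x) 𝐋_{ν+1}` (`hasDerivAt_struveL_add_one`), where
`a_ν = 1/(√π 2^ν Γ(ν+3/2))`; both follow from termwise differentiation of the series for `ν > -1`.

Inequalities are proved by exhibiting a function with positive derivative on `(0, ∞)` whose negative
part vanishes at `0+` (`pos_of_hasDerivAt_pos`). Applied to `e^x x^{-ν} (𝐋_ν - 𝐋_{ν+1})` this gives
`𝐋_{ν+1} < 𝐋_ν` for `ν ≥ -1/2`, and applied to `e^x x^{1-μ} (𝐋_μ - (1 + 1/x) 𝐋_{μ+1})` it gives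
`(1 + 1/x) 𝐋_{μ+1} < 𝐋_μ` for `μ ≥ 1/2`. Write `F` for the integral and `W = e^{-βx} x^ν 𝐋_ν`, so
that `F' = W`. The incomplete gamma term is the primitive of `e^{-βx} x^ν · a_ν x^ν`, so it cancels
the inhomogeneous term of `W'`, and the first two bounds follow by comparing `(1-β) F'` with the
derivative of `W` minus that primitive, respectively of `(1 - c/x) W` minus it: the first
monotonicity suffices when `ν ≤ 0`, and the second one with `μ = ν - 1` absorbs `2ν/x` when
`ν ≥ 3/2`. For the third bound the derivatives of the terms `β^k e^{-βx} x^ν 𝐋_{ν+k+1}` telescope;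
the slack in the first step is at least the derivative of `e^{-βx} x^{ν-1} 𝐋_{ν+2}`, which gives
convergence of the series and strictness (`sum_add_lt_struveIntegral`).

For tightness, l'Hôpital's rule applied to `e^x (𝐋_ν - 𝐋_{ν+1})` and `e^x (𝐋_ν + 𝐋_{ν+1})` shows
`𝐋_{ν+1}/𝐋_ν → 1` at infinity (`tendsto_struveL_add_one_div`), hence `W'/W → 1 - β`, so `W → ∞` and,
by l'Hôpital's rule again, `W/F → 1 - β`. The gamma term is bounded and `F → ∞`, which settles the
first two bounds; the first `N` terms of the third bound are asymptotic to `(1 - β^N) F`, and the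
bound itself is below `F`.
-/

/-! ### The series of `𝐋_ν` and its derivative -/

/-- The `k`-th term of the series defining `struveL ν x`. -/
noncomputable def struveTerm (ν x : ℝ) (k : ℕ) : ℝ :=
  (x / 2) ^ (ν + 2 * (k : ℝ) + 1) /
    (Real.Gamma ((k : ℝ) + 3 / 2) * Real.Gamma ((k : ℝ) + ν + 3 / 2))

/-- The coefficient `1 / (√π 2^ν Γ(ν + 3/2))` of `x^ν` in the inhomogeneous term of the
recurrence `𝐋_{ν-1} - 𝐋_{ν+1} = (2ν/x) 𝐋_ν + struveCoeff ν * x^ν`. -/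
noncomputable def struveCoeff (ν : ℝ) : ℝ :=
  1 / (√Real.pi * (2 : ℝ) ^ ν * Real.Gamma (ν + 3 / 2))

theorem struveCoeff_pos {ν : ℝ} (hν : -1 < ν) : 0 < struveCoeff ν := by
  have := Real.Gamma_pos_of_pos (show 0 < ν + 3 / 2 by linarith)
  have := Real.pi_pos
  unfold struveCoeff
  positivity

theorem struveTerm_pos {ν x : ℝ} (hν : -1 < ν) (hx : 0 < x) (k : ℕ) : 0 < struveTerm ν x k := by
  have hk : (0 : ℝ) ≤ k := k.cast_nonneg
  have := Real.Gamma_pos_of_pos (show 0 < (k : ℝ) + 3 / 2 by linarith)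
  have := Real.Gamma_pos_of_pos (show 0 < (k : ℝ) + ν + 3 / 2 by linarith)
  unfold struveTerm
  positivity

/-- Multiplying by `2k + 3` lowers the factor `Γ(k + 5/2)` of the term of index `k + 1` to
`Γ(k + 3/2)`, which gives a term of the series of order `ν + 1`. The next two lemmas are the case of
the term of index `0`, and the analogue for the factor that involves `ν`. -/
theorem odd_mul_struveTerm_succ (ν : ℝ) {x : ℝ} (hx : 0 < x) (k : ℕ) :
    (2 * ((k + 1 : ℕ) : ℝ) + 1) / x * struveTerm ν x (k + 1) = struveTerm (ν + 1) x k := by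
  have hk : (0 : ℝ) ≤ k := k.cast_nonneg
  have hG := Real.Gamma_add_one (show (k : ℝ) + 3 / 2 ≠ 0 by positivity)
  have hG0 := (Real.Gamma_pos_of_pos (show 0 < (k : ℝ) + 3 / 2 by positivity)).ne'
  have hp : (x / 2) ^ (ν + 2 * ((k + 1 : ℕ) : ℝ) + 1) =
      (x / 2) ^ (ν + 1 + 2 * (k : ℝ) + 1) * (x / 2) := by
    rw [← Real.rpow_add_one (by positivity)]; push_cast; ring_nf
  unfold struveTerm
  rw [hp, show ((k + 1 : ℕ) : ℝ) + 3 / 2 = (k : ℝ) + 3 / 2 + 1 by push_cast; ring, hG,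
    show ((k + 1 : ℕ) : ℝ) + ν + 3 / 2 = (k : ℝ) + (ν + 1) + 3 / 2 by push_cast; ring]
  have h2 : (k : ℝ) + 3 / 2 ≠ 0 := by positivity
  generalize Real.Gamma ((k : ℝ) + (ν + 1) + 3 / 2) = g
  generalize (x / 2) ^ (ν + 1 + 2 * (k : ℝ) + 1) = p
  have h3 : (2 * ((k + 1 : ℕ) : ℝ) + 1) = 2 * ((k : ℝ) + 3 / 2) := by push_cast; ring
  rw [h3]
  generalize (k : ℝ) + 3 / 2 = m at *
  field_simp

theorem inv_mul_struveTerm_zero {ν x : ℝ} (hx : 0 < x) :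
    1 / x * struveTerm ν x 0 = struveCoeff ν * x ^ ν := by
  have h1 : Real.Gamma (3 / 2) = 1 / 2 * √Real.pi := by
    rw [show (3 / 2 : ℝ) = 1 / 2 + 1 by norm_num, Real.Gamma_add_one (by norm_num),
      Real.Gamma_one_half_eq]
  have hπ := (Real.sqrt_pos.2 Real.pi_pos).ne'
  unfold struveTerm struveCoeff
  simp only [Nat.cast_zero, mul_zero, add_zero, zero_add]
  rw [h1, Real.rpow_add_one (by positivity), Real.div_rpow hx.le (by norm_num)]
  have := (Real.rpow_pos_of_pos (show (0 : ℝ) < 2 by norm_num) ν).ne'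
  generalize Real.Gamma (ν + 3 / 2) = g
  field_simp

theorem weight_mul_struveTerm {ν x : ℝ} (hν : -1 < ν) (hx : 0 < x) (k : ℕ) :
    (2 * ν + 2 * (k : ℝ) + 3) / x * struveTerm (ν + 1) x k = struveTerm ν x k := by
  have hk : (0 : ℝ) ≤ k := k.cast_nonneg
  have h0 : 0 < (k : ℝ) + ν + 3 / 2 := by linarith
  have hp : (x / 2) ^ (ν + 1 + 2 * (k : ℝ) + 1) =
      (x / 2) ^ (ν + 2 * (k : ℝ) + 1) * (x / 2) := by
    rw [← Real.rpow_add_one (by positivity)]; ring_nf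
  have hG0 := (Real.Gamma_pos_of_pos h0).ne'
  have h2 := h0.ne'
  unfold struveTerm
  rw [hp, show (k : ℝ) + (ν + 1) + 3 / 2 = (k : ℝ) + ν + 3 / 2 + 1 by ring,
    Real.Gamma_add_one h2,
    show 2 * ν + 2 * (k : ℝ) + 3 = 2 * ((k : ℝ) + ν + 3 / 2) by ring]
  generalize (k : ℝ) + ν + 3 / 2 = m at *
  generalize Real.Gamma ((k : ℝ) + 3 / 2) = g
  field_simp

theorem struveTerm_succ {ν x : ℝ} (hν : -1 < ν) (hx : 0 < x) (k : ℕ) :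
    struveTerm ν x (k + 1) =
      x ^ 2 / ((2 * (k : ℝ) + 3) * (2 * ν + 2 * (k : ℝ) + 3)) * struveTerm ν x k := by
  have hk : (0 : ℝ) ≤ k := k.cast_nonneg
  have h1 := odd_mul_struveTerm_succ ν hx k
  have h2 := weight_mul_struveTerm hν hx k
  rw [← h2, ← h1]
  have h3 : 2 * ν + 2 * (k : ℝ) + 3 ≠ 0 := by linarith
  have h4 : 2 * (k : ℝ) + 3 ≠ 0 := by linarith
  rw [show 2 * ((k + 1 : ℕ) : ℝ) + 1 = 2 * (k : ℝ) + 3 by push_cast; ring]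
  generalize 2 * ν + 2 * (k : ℝ) + 3 = m at *
  field_simp

theorem summable_struveTerm {ν x : ℝ} (hν : -1 < ν) (hx : 0 < x) :
    Summable (struveTerm ν x) := by
  refine summable_of_ratio_test_tendsto_lt_one zero_lt_one
    (Eventually.of_forall fun k => (struveTerm_pos hν hx k).ne') ?_
  have hcast : Tendsto (fun k : ℕ => (k : ℝ)) atTop atTop := tendsto_natCast_atTop_atTop
  have hden : Tendsto (fun k : ℕ => (2 * (k : ℝ) + 3) * (2 * ν + 2 * (k : ℝ) + 3))
      atTop atTop := by
    refine Tendsto.atTop_mul_atTop₀ ?_ ?_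
    · exact tendsto_atTop_add_const_right _ _ (hcast.const_mul_atTop two_pos)
    · exact tendsto_atTop_add_const_right _ _
        (tendsto_atTop_add_const_left _ _ (hcast.const_mul_atTop two_pos))
  refine (hden.const_div_atTop (x ^ 2)).congr fun k => ?_
  have hk : (0 : ℝ) ≤ k := k.cast_nonneg
  rw [Real.norm_of_nonneg (struveTerm_pos hν hx _).le,
    Real.norm_of_nonneg (struveTerm_pos hν hx _).le, struveTerm_succ hν hx,
    mul_div_cancel_right₀ _ (struveTerm_pos hν hx k).ne']

theorem hasSum_struveTerm {ν x : ℝ} (hν : -1 < ν) (hx : 0 < x) :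
    HasSum (struveTerm ν x) (struveL ν x) :=
  (summable_struveTerm hν hx).hasSum

theorem struveL_pos {ν x : ℝ} (hν : -1 < ν) (hx : 0 < x) : 0 < struveL ν x :=
  (summable_struveTerm hν hx).tsum_pos (fun k => (struveTerm_pos hν hx k).le) 0
    (struveTerm_pos hν hx 0)

theorem hasSum_odd_mul_struveTerm {ν x : ℝ} (hν : -1 < ν) (hx : 0 < x) :
    HasSum (fun k : ℕ => (2 * (k : ℝ) + 1) / x * struveTerm ν x k)
      (struveL (ν + 1) x + struveCoeff ν * x ^ ν) := by
  have h : HasSum (fun k : ℕ => (2 * ((k + 1 : ℕ) : ℝ) + 1) / x * struveTerm ν x (k + 1))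
      (struveL (ν + 1) x) := by
    simp_rw [odd_mul_struveTerm_succ ν hx]
    exact hasSum_struveTerm (by linarith) hx
  have h' := (hasSum_nat_add_iff (f := fun k : ℕ => (2 * (k : ℝ) + 1) / x * struveTerm ν x k) 1).1 h
  simpa [← inv_mul_struveTerm_zero hx] using h'

theorem hasSum_exponent_mul_struveTerm {ν x : ℝ} (hν : -1 < ν) (hx : 0 < x) :
    HasSum (fun k : ℕ => (ν + 2 * (k : ℝ) + 1) / x * struveTerm ν x k)
      (struveL (ν + 1) x + struveCoeff ν * x ^ ν + ν / x * struveL ν x) := by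
  refine ((hasSum_odd_mul_struveTerm hν hx).add
    ((hasSum_struveTerm hν hx).mul_left (ν / x))).congr_fun fun k => ?_
  ring

theorem hasDerivAt_struveTerm (ν : ℝ) {x : ℝ} (hx : 0 < x) (k : ℕ) :
    HasDerivAt (fun y => struveTerm ν y k)
      ((ν + 2 * (k : ℝ) + 1) / x * struveTerm ν x k) x := by
  have h := (((hasDerivAt_id x).div_const 2).rpow_const
    (p := ν + 2 * (k : ℝ) + 1) (Or.inl (by simp [hx.ne']))).div_const
    (Real.Gamma ((k : ℝ) + 3 / 2) * Real.Gamma ((k : ℝ) + ν + 3 / 2))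
  refine h.congr_deriv ?_
  simp only [id]
  rw [Real.rpow_sub_one (by positivity), struveTerm]
  field_simp

theorem struveTerm_mono {ν x y : ℝ} (hν : -1 < ν) (hx : 0 < x) (hxy : x ≤ y) (k : ℕ) :
    struveTerm ν x k ≤ struveTerm ν y k := by
  have hk : (0 : ℝ) ≤ k := k.cast_nonneg
  have := Real.Gamma_pos_of_pos (show 0 < (k : ℝ) + 3 / 2 by linarith)
  have := Real.Gamma_pos_of_pos (show 0 < (k : ℝ) + ν + 3 / 2 by linarith)
  unfold struveTerm
  gcongr
  linarith

theorem hasDerivAt_struveL {ν x : ℝ} (hν : -1 < ν) (hx : 0 < x) :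
    HasDerivAt (struveL ν)
      (struveL (ν + 1) x + struveCoeff ν * x ^ ν + ν / x * struveL ν x) x := by
  rw [← (hasSum_exponent_mul_struveTerm hν hx).tsum_eq]
  have h2x : 0 < 2 * x := by linarith
  -- on `(x/2, 2x)` the derivatives are dominated by a multiple of those at `2x`
  have hu : Summable fun k : ℕ =>
      4 * ((ν + 2 * (k : ℝ) + 1) / (2 * x) * struveTerm ν (2 * x) k) :=
    (hasSum_exponent_mul_struveTerm hν h2x).summable.mul_left 4
  refine hasDerivAt_tsum_of_isPreconnected (t := Set.Ioo (x / 2) (2 * x)) hu isOpen_Ioo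
    isPreconnected_Ioo (fun k y hy => hasDerivAt_struveTerm ν (by linarith [hy.1]) k)
    (fun k y hy => ?_) (y₀ := x) ⟨by linarith, by linarith⟩ (summable_struveTerm hν hx)
    ⟨by linarith, by linarith⟩
  have hy0 : 0 < y := by linarith [hy.1]
  have hk : (0 : ℝ) ≤ k := k.cast_nonneg
  have he : 0 < ν + 2 * (k : ℝ) + 1 := by linarith
  have ht := struveTerm_pos hν hy0 k
  rw [Real.norm_of_nonneg (by positivity)]
  calc (ν + 2 * (k : ℝ) + 1) / y * struveTerm ν y k
      ≤ (ν + 2 * (k : ℝ) + 1) / (x / 2) * struveTerm ν (2 * x) k := by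
        gcongr
        · exact hy.1.le
        · exact struveTerm_mono hν hy0 hy.2.le k
    _ = _ := by field_simp; ring

theorem hasDerivAt_struveL_add_one {ν x : ℝ} (hν : -1 < ν) (hx : 0 < x) :
    HasDerivAt (struveL (ν + 1)) (struveL ν x - (ν + 1) / x * struveL (ν + 1) x) x := by
  have hν' : -1 < ν + 1 := by linarith
  refine (hasDerivAt_struveL hν' hx).congr_deriv ?_
  refine (hasSum_exponent_mul_struveTerm hν' hx).unique ?_
  refine ((hasSum_struveTerm hν hx).sub
    ((hasSum_struveTerm hν' hx).mul_left ((ν + 1) / x))).congr_fun fun k => ?_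
  rw [← weight_mul_struveTerm hν hx k]
  ring

theorem struveL_le_mul_rpow {ν x y : ℝ} (hν : -1 < ν) (hx : 0 < x) (hxy : x ≤ y) :
    struveL ν x ≤ struveL ν y / y ^ (ν + 1) * x ^ (ν + 1) := by
  have hy := hx.trans_le hxy
  rw [div_mul_eq_mul_div, mul_div_assoc, ← Real.div_rpow hx.le hy.le]
  refine hasSum_le (fun k => ?_) (hasSum_struveTerm hν hx)
    ((hasSum_struveTerm hν hy).mul_right _)
  have hk : (0 : ℝ) ≤ k := k.cast_nonneg
  have := Real.Gamma_pos_of_pos (show 0 < (k : ℝ) + 3 / 2 by linarith)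
  have := Real.Gamma_pos_of_pos (show 0 < (k : ℝ) + ν + 3 / 2 by linarith)
  unfold struveTerm
  rw [div_mul_eq_mul_div]
  gcongr
  have e1 : (x / 2) ^ (ν + 2 * (k : ℝ) + 1) = (y / 2) ^ (ν + 2 * (k : ℝ) + 1) *
      ((x / y) ^ (ν + 1) * (x / y) ^ (2 * (k : ℝ))) := by
    rw [← Real.rpow_add (by positivity), show ν + 1 + 2 * (k : ℝ) = ν + 2 * (k : ℝ) + 1 by ring,
      ← Real.mul_rpow (by positivity) (by positivity)]
    congr 1; field_simp
  rw [e1]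
  have h1 : (x / y) ^ (2 * (k : ℝ)) ≤ 1 :=
    Real.rpow_le_one (by positivity) ((div_le_one hy).2 hxy) (by positivity)
  have h2 : 0 < (x / y) ^ (ν + 1) := by positivity
  have h3 : 0 < (y / 2) ^ (ν + 2 * (k : ℝ) + 1) := by positivity
  gcongr
  exact mul_le_of_le_one_right h2.le h1

/-- Near `0` the function `𝐋_ν` is of order `x^(ν+1)`. -/
theorem tendsto_rpow_mul_struveL {ν p : ℝ} (hν : -1 < ν) (hp : 0 < p + ν + 1) :
    Tendsto (fun x => x ^ p * struveL ν x) (𝓝[>] 0) (𝓝 0) := by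
  have h0 : Tendsto (fun x : ℝ => struveL ν 1 * x ^ (p + ν + 1)) (𝓝[>] 0) (𝓝 0) := by
    have h := ((Real.continuousAt_rpow_const 0 (p + ν + 1) (Or.inr hp.le)).tendsto.mono_left
      (nhdsWithin_le_nhds (s := Set.Ioi 0))).const_mul (struveL ν 1)
    simpa [Real.zero_rpow hp.ne'] using h
  refine tendsto_of_tendsto_of_tendsto_of_le_of_le' tendsto_const_nhds h0 ?_ ?_
  · filter_upwards [self_mem_nhdsWithin] with x hx
    have hx : (0 : ℝ) < x := hx
    have := struveL_pos hν hx
    positivity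
  · filter_upwards [Ioo_mem_nhdsGT (zero_lt_one (α := ℝ))] with x hx
    have h := struveL_le_mul_rpow hν hx.1 hx.2.le
    rw [Real.one_rpow, div_one] at h
    have hx0 : 0 < x := hx.1
    calc x ^ p * struveL ν x ≤ x ^ p * (struveL ν 1 * x ^ (ν + 1)) := by gcongr
      _ = _ := by rw [show p + ν + 1 = p + (ν + 1) by ring, Real.rpow_add hx0 p (ν + 1)]; ring

theorem tendsto_exp_mul_rpow_mul_struveL (b : ℝ) {ν p : ℝ} (hν : -1 < ν) (hp : 0 < p + ν + 1) :
    Tendsto (fun x => Real.exp (-(b * x)) * x ^ p * struveL ν x) (𝓝[>] 0) (𝓝 0) := by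
  have h1 : Tendsto (fun x : ℝ => Real.exp (-(b * x))) (𝓝[>] 0) (𝓝 1) := by
    have : Continuous fun x : ℝ => Real.exp (-(b * x)) := by fun_prop
    simpa using (this.tendsto 0).mono_left (nhdsWithin_le_nhds (s := Set.Ioi 0))
  simpa [mul_assoc] using h1.mul (tendsto_rpow_mul_struveL hν hp)

theorem hasDerivAt_exp_mul_rpow (b p : ℝ) {x : ℝ} (hx : 0 < x) :
    HasDerivAt (fun y => Real.exp (-(b * y)) * y ^ p)
      (Real.exp (-(b * x)) * x ^ p * (p / x - b)) x := by
  have h1 : HasDerivAt (fun y : ℝ => Real.exp (-(b * y))) (Real.exp (-(b * x)) * (-(b * 1))) x :=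
    ((hasDerivAt_id x).const_mul b).neg.exp
  refine (h1.mul (Real.hasDerivAt_rpow_const (p := p) (Or.inl hx.ne'))).congr_deriv ?_
  rw [Real.rpow_sub_one hx.ne']
  ring

theorem hasDerivAt_exp_mul_rpow_mul_struveL (b p : ℝ) {ν x : ℝ} (hν : -1 < ν) (hx : 0 < x) :
    HasDerivAt (fun y => Real.exp (-(b * y)) * y ^ p * struveL ν y)
      (Real.exp (-(b * x)) * x ^ p *
        (struveL (ν + 1) x + struveCoeff ν * x ^ ν + ((ν + p) / x - b) * struveL ν x)) x := by
  refine ((hasDerivAt_exp_mul_rpow b p hx).mul (hasDerivAt_struveL hν hx)).congr_deriv ?_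
  ring

theorem hasDerivAt_exp_mul_rpow_mul_struveL_add_one (b p : ℝ) {ν x : ℝ} (hν : -1 < ν)
    (hx : 0 < x) :
    HasDerivAt (fun y => Real.exp (-(b * y)) * y ^ p * struveL (ν + 1) y)
      (Real.exp (-(b * x)) * x ^ p *
        (struveL ν x + ((p - ν - 1) / x - b) * struveL (ν + 1) x)) x := by
  refine ((hasDerivAt_exp_mul_rpow b p hx).mul
    (hasDerivAt_struveL_add_one hν hx)).congr_deriv ?_
  ring

/-! ### The integrals -/

/-- The comparison principle behind all the inequalities: a strictly increasing function on `(0, ∞)`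
whose negative part vanishes at `0+` is positive. -/
theorem pos_of_hasDerivAt_pos {G G' ρ : ℝ → ℝ} (hG : ∀ x, 0 < x → HasDerivAt G (G' x) x)
    (hG' : ∀ x, 0 < x → 0 < G' x) (hρ : Tendsto ρ (𝓝[>] 0) (𝓝 0))
    (hGρ : ∀ x, 0 < x → -ρ x ≤ G x) {x : ℝ} (hx : 0 < x) : 0 < G x := by
  have hmono : StrictMonoOn G (Set.Ioi 0) := by
    refine strictMonoOn_of_deriv_pos (convex_Ioi 0)
      (fun y hy => (hG y hy).continuousAt.continuousWithinAt) fun y hy => ?_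
    rw [interior_Ioi] at hy
    rw [(hG y hy).deriv]
    exact hG' y hy
  have hx2 : 0 < x / 2 := by linarith
  have h1 : G (x / 2) < G x := hmono hx2 hx (by linarith)
  have h2 : 0 ≤ G (x / 2) := by
    have hlim : Tendsto (fun y => -ρ y) (𝓝[>] 0) (𝓝 0) := by simpa using hρ.neg
    refine le_of_tendsto hlim ?_
    filter_upwards [Ioo_mem_nhdsGT hx2] with y hy
    exact (hGρ y hy.1).trans (hmono hy.1 hx2 hy.2).le
  linarith

theorem intervalIntegrable_struve (β : ℝ) {ν x : ℝ} (hν : -1 < ν) (hx : 0 < x) :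
    IntervalIntegrable (fun t : ℝ => Real.exp (-(β * t)) * t ^ ν * struveL ν t) volume 0 x := by
  have hcont : ContinuousOn (fun t : ℝ => Real.exp (-(β * t)) * t ^ ν * struveL ν t)
      (Set.Ioi 0) := fun t ht =>
    (hasDerivAt_exp_mul_rpow_mul_struveL β ν hν ht).continuousAt.continuousWithinAt
  have hdom : IntervalIntegrable
      (fun t : ℝ => Real.exp (-(β * t)) * (struveL ν x / x ^ (ν + 1) * t ^ (2 * ν + 1)))
      volume 0 x :=
    ((intervalIntegral.intervalIntegrable_rpow' (by linarith)).const_mul _).continuousOn_mul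
      (by fun_prop)
  refine hdom.mono_fun ?_ ?_
  · rw [Set.uIoc_of_le hx.le]
    exact (hcont.mono fun t ht => ht.1).aestronglyMeasurable measurableSet_Ioc
  · rw [Set.uIoc_of_le hx.le]
    filter_upwards [ae_restrict_mem measurableSet_Ioc] with t ht
    have ht0 : 0 < t := ht.1
    have hL := struveL_pos hν ht0
    have hLx := struveL_pos hν hx
    rw [Real.norm_of_nonneg (by positivity), Real.norm_of_nonneg (by positivity), mul_assoc]
    refine mul_le_mul_of_nonneg_left ?_ (Real.exp_pos _).le
    calc t ^ ν * struveL ν t ≤ t ^ ν * (struveL ν x / x ^ (ν + 1) * t ^ (ν + 1)) := by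
          gcongr
          exact struveL_le_mul_rpow hν ht0 ht.2
      _ = _ := by rw [show 2 * ν + 1 = ν + (ν + 1) by ring, Real.rpow_add ht0 ν (ν + 1)]; ring

theorem hasDerivAt_integral_of_continuousOn_Ioi {f : ℝ → ℝ} (hf : ContinuousOn f (Set.Ioi 0))
    {x : ℝ} (hx : 0 < x) (hint : IntervalIntegrable f volume 0 x) :
    HasDerivAt (fun y => ∫ t in (0 : ℝ)..y, f t) (f x) x :=
  intervalIntegral.integral_hasDerivAt_right hint
    (hf.stronglyMeasurableAtFilter isOpen_Ioi x hx) (hf.continuousAt (Ioi_mem_nhds hx))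

theorem hasDerivAt_struveIntegral (β : ℝ) {ν x : ℝ} (hν : -1 < ν) (hx : 0 < x) :
    HasDerivAt (struveIntegral β ν) (Real.exp (-(β * x)) * x ^ ν * struveL ν x) x :=
  hasDerivAt_integral_of_continuousOn_Ioi
    (fun _ ht => (hasDerivAt_exp_mul_rpow_mul_struveL β ν hν ht).continuousAt.continuousWithinAt)
    hx (intervalIntegrable_struve β hν hx)

theorem struveIntegral_nonneg (β : ℝ) {ν x : ℝ} (hν : -1 < ν) (hx : 0 < x) :
    0 ≤ struveIntegral β ν x := by
  refine intervalIntegral.integral_nonneg_of_ae_restrict hx.le ?_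
  rw [restrict_Ioc_eq_restrict_Icc.symm]
  filter_upwards [ae_restrict_mem measurableSet_Ioc] with t ht
  have ht0 : 0 < t := ht.1
  have hL := struveL_pos hν ht0
  simp only [Pi.zero_apply]
  positivity

theorem lowerGamma_nonneg (a : ℝ) {x : ℝ} (hx : 0 < x) : 0 ≤ lowerGamma a x :=
  intervalIntegral.integral_nonneg hx.le fun _ ht =>
    mul_nonneg (Real.exp_pos _).le (Real.rpow_nonneg ht.1 _)

theorem intervalIntegrable_lowerGamma {a x : ℝ} (ha : 0 < a) (hx : 0 < x) :
    IntervalIntegrable (fun t : ℝ => Real.exp (-t) * t ^ (a - 1)) volume 0 x := by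
  rw [intervalIntegrable_iff_integrableOn_Ioc_of_le hx.le]
  exact (Real.GammaIntegral_convergent ha).mono_set Set.Ioc_subset_Ioi_self

theorem hasDerivAt_lowerGamma {a x : ℝ} (ha : 0 < a) (hx : 0 < x) :
    HasDerivAt (lowerGamma a) (Real.exp (-x) * x ^ (a - 1)) x := by
  refine hasDerivAt_integral_of_continuousOn_Ioi (fun t ht => ?_) hx
    (intervalIntegrable_lowerGamma ha hx)
  exact ((by fun_prop : Continuous fun t : ℝ => Real.exp (-t)).continuousAt.mul
    (Real.continuousAt_rpow_const t (a - 1) (Or.inl (ne_of_gt ht)))).continuousWithinAt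

theorem lowerGamma_le_Gamma {a x : ℝ} (ha : 0 < a) (hx : 0 < x) :
    lowerGamma a x ≤ Real.Gamma a := by
  rw [lowerGamma, intervalIntegral.integral_of_le hx.le, Real.Gamma_eq_integral ha]
  refine setIntegral_mono_set (Real.GammaIntegral_convergent ha) ?_
    Set.Ioc_subset_Ioi_self.eventuallyLE
  filter_upwards [ae_restrict_mem measurableSet_Ioi] with t ht
  have ht0 : (0 : ℝ) < t := ht
  simp only [Pi.zero_apply]
  positivity

/-- The incomplete gamma term subtracted in the first two lower bounds. -/
noncomputable def gammaCorrection (β ν x : ℝ) : ℝ :=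
  lowerGamma (2 * ν + 1) (β * x) /
    (√Real.pi * (2 : ℝ) ^ ν * β ^ (2 * ν + 1) * Real.Gamma (ν + 3 / 2))

/-- The derivative of the incomplete gamma term is the inhomogeneous term of the derivative of
`e^{-βx} x^ν 𝐋_ν(x)`. -/
theorem hasDerivAt_gammaCorrection {β ν x : ℝ} (hβ : 0 < β) (hν : -(1 / 2) < ν) (hx : 0 < x) :
    HasDerivAt (gammaCorrection β ν)
      (Real.exp (-(β * x)) * x ^ ν * (struveCoeff ν * x ^ ν)) x := by
  have hβx : 0 < β * x := mul_pos hβ hx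
  have h := ((hasDerivAt_lowerGamma (a := 2 * ν + 1) (by linarith) hβx).comp x
    ((hasDerivAt_id x).const_mul β)).div_const
    (√Real.pi * (2 : ℝ) ^ ν * β ^ (2 * ν + 1) * Real.Gamma (ν + 3 / 2))
  refine h.congr_deriv ?_
  have hG := (Real.Gamma_pos_of_pos (show 0 < ν + 3 / 2 by linarith)).ne'
  have hπ := (Real.sqrt_pos.2 Real.pi_pos).ne'
  have h2 := (Real.rpow_pos_of_pos (show (0 : ℝ) < 2 by norm_num) ν).ne'
  have hb := (Real.rpow_pos_of_pos hβ (2 * ν)).ne'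
  rw [add_sub_cancel_right, Real.mul_rpow hβ.le hx.le, Real.rpow_add_one hβ.ne', struveCoeff,
    show x ^ (2 * ν) = x ^ ν * x ^ ν by rw [← Real.rpow_add hx]; ring_nf]
  field_simp

theorem gammaCorrection_nonneg {β ν x : ℝ} (hβ : 0 < β) (hν : -(1 / 2) < ν) (hx : 0 < x) :
    0 ≤ gammaCorrection β ν x := by
  have h1 := lowerGamma_nonneg (2 * ν + 1) (mul_pos hβ hx)
  have h2 := Real.Gamma_pos_of_pos (show 0 < ν + 3 / 2 by linarith)
  unfold gammaCorrection
  positivity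

theorem gammaCorrection_le {β ν x : ℝ} (hβ : 0 < β) (hν : -(1 / 2) < ν) (hx : 0 < x) :
    gammaCorrection β ν x ≤ Real.Gamma (2 * ν + 1) /
      (√Real.pi * (2 : ℝ) ^ ν * β ^ (2 * ν + 1) * Real.Gamma (ν + 3 / 2)) := by
  have h2 := Real.Gamma_pos_of_pos (show 0 < ν + 3 / 2 by linarith)
  unfold gammaCorrection
  gcongr
  exact lowerGamma_le_Gamma (by linarith) (mul_pos hβ hx)

/-! ### Monotonicity of `𝐋_ν` in the order -/

theorem struveL_add_one_lt {ν x : ℝ} (hν : -(1 / 2) ≤ ν) (hx : 0 < x) :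
    struveL (ν + 1) x < struveL ν x := by
  have hν1 : -1 < ν := by linarith
  have hG : ∀ y, 0 < y → HasDerivAt (fun y => Real.exp (-(-1 * y)) * y ^ (-ν) * struveL ν y -
      Real.exp (-(-1 * y)) * y ^ (-ν) * struveL (ν + 1) y)
      (Real.exp (-(-1 * y)) * y ^ (-ν) *
        (struveCoeff ν * y ^ ν + (2 * ν + 1) / y * struveL (ν + 1) y)) y := fun y hy => by
    refine ((hasDerivAt_exp_mul_rpow_mul_struveL (-1) (-ν) hν1 hy).sub
      (hasDerivAt_exp_mul_rpow_mul_struveL_add_one (-1) (-ν) hν1 hy)).congr_deriv ?_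
    ring
  have h := pos_of_hasDerivAt_pos hG (fun y hy => ?_)
    (tendsto_exp_mul_rpow_mul_struveL (-1) (ν := ν + 1) (p := -ν) (by linarith) (by linarith))
    (fun y hy => ?_) hx
  · rw [← mul_sub] at h
    exact sub_pos.1 (pos_of_mul_pos_right h (by positivity))
  · have h1 := struveCoeff_pos hν1
    have h2 := struveL_pos (show -1 < ν + 1 by linarith) hy
    have h3 : 0 ≤ (2 * ν + 1) / y * struveL (ν + 1) y :=
      mul_nonneg (div_nonneg (by linarith) hy.le) h2.le
    positivity
  · have h2 := struveL_pos hν1 hy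
    have : 0 < Real.exp (-(-1 * y)) * y ^ (-ν) * struveL ν y := by positivity
    linarith

/-- A quantitative version of the monotonicity in the order: the gain `1 + 1/x` is what the
second bound needs. -/
theorem one_add_inv_mul_struveL_add_one_lt {μ x : ℝ} (hμ : 1 / 2 ≤ μ) (hx : 0 < x) :
    (1 + 1 / x) * struveL (μ + 1) x < struveL μ x := by
  have hμ1 : -1 < μ := by linarith
  have hp : ∀ y : ℝ, 0 < y → y ^ (1 - μ) = y ^ (-μ) * y := fun y hy => by
    rw [← Real.rpow_add_one hy.ne']; ring_nf
  have hG : ∀ y, 0 < y → HasDerivAt (fun y => Real.exp (-(-1 * y)) * y ^ (1 - μ) * struveL μ y -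
      (Real.exp (-(-1 * y)) * y ^ (1 - μ) * struveL (μ + 1) y +
        Real.exp (-(-1 * y)) * y ^ (-μ) * struveL (μ + 1) y))
      (Real.exp (-(-1 * y)) * y ^ (-μ) * (y * (struveCoeff μ * y ^ μ) +
        ((2 * μ - 1) + (2 * μ + 1) / y) * struveL (μ + 1) y)) y := fun y hy => by
    refine ((hasDerivAt_exp_mul_rpow_mul_struveL (-1) (1 - μ) hμ1 hy).sub
      ((hasDerivAt_exp_mul_rpow_mul_struveL_add_one (-1) (1 - μ) hμ1 hy).add
      (hasDerivAt_exp_mul_rpow_mul_struveL_add_one (-1) (-μ) hμ1 hy))).congr_deriv ?_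
    rw [hp y hy]
    field_simp
    ring
  have hρ := (tendsto_exp_mul_rpow_mul_struveL (-1) (ν := μ + 1) (p := 1 - μ) (by linarith)
    (by linarith)).add (tendsto_exp_mul_rpow_mul_struveL (-1) (ν := μ + 1) (p := -μ)
      (by linarith) (by linarith))
  rw [add_zero] at hρ
  have h := pos_of_hasDerivAt_pos hG (fun y hy => ?_) hρ (fun y hy => ?_) hx
  · rw [hp x hx] at h
    have h' : 0 < Real.exp (-(-1 * x)) * x ^ (-μ) * x *
        (struveL μ x - (1 + 1 / x) * struveL (μ + 1) x) := by
      refine h.trans_eq ?_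
      field_simp
    exact sub_pos.1 (pos_of_mul_pos_right h' (by positivity))
  · have h1 := struveCoeff_pos hμ1
    have h2 := struveL_pos (show -1 < μ + 1 by linarith) hy
    have h3 : 0 < (2 * μ - 1) + (2 * μ + 1) / y := by
      have : 0 < (2 * μ + 1) / y := div_pos (by linarith) hy
      linarith
    positivity
  · have h2 := struveL_pos hμ1 hy
    have : 0 < Real.exp (-(-1 * y)) * y ^ (1 - μ) * struveL μ y := by positivity
    linarith

/-! ### The three inequalities -/

theorem lowerBound₁_lt {β ν x : ℝ} (hβ0 : 0 < β) (hβ1 : β < 1) (hν : -(1 / 2) < ν) (hν0 : ν ≤ 0)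
    (hx : 0 < x) : lowerBound₁ β ν x < struveIntegral β ν x := by
  have hν1 : -1 < ν := by linarith
  have hG : ∀ y, 0 < y → HasDerivAt (fun y => (1 - β) * struveIntegral β ν y -
      (Real.exp (-(β * y)) * y ^ ν * struveL ν y - gammaCorrection β ν y))
      (Real.exp (-(β * y)) * y ^ ν *
        ((struveL ν y - struveL (ν + 1) y) + -(2 * ν) / y * struveL ν y)) y := fun y hy => by
    refine (((hasDerivAt_struveIntegral β hν1 hy).const_mul (1 - β)).sub
      ((hasDerivAt_exp_mul_rpow_mul_struveL β ν hν1 hy).sub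
        (hasDerivAt_gammaCorrection hβ0 hν hy))).congr_deriv ?_
    ring
  have h := pos_of_hasDerivAt_pos hG (fun y hy => ?_)
    (tendsto_exp_mul_rpow_mul_struveL β (p := ν) hν1 (by linarith)) (fun y hy => ?_) hx
  · change 1 / (1 - β) * (Real.exp (-(β * x)) * x ^ ν * struveL ν x - gammaCorrection β ν x) < _
    rw [one_div_mul_eq_div, div_lt_iff₀' (by linarith)]
    linarith
  · have h1 := struveL_add_one_lt hν.le hy
    have h2 : 0 ≤ -(2 * ν) / y * struveL ν y :=
      mul_nonneg (div_nonneg (by linarith) hy.le) (struveL_pos hν1 hy).le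
    have h3 : 0 < Real.exp (-(β * y)) * y ^ ν := by positivity
    exact mul_pos h3 (by linarith)
  · have h1 := mul_nonneg (sub_nonneg.2 hβ1.le) (struveIntegral_nonneg β hν1 hy)
    have h2 := gammaCorrection_nonneg hβ0 hν hy
    linarith

theorem lowerBound₂_eq (β ν : ℝ) {x : ℝ} (hx : 0 < x) :
    lowerBound₂ β ν x = 1 / (1 - β) * (Real.exp (-(β * x)) * x ^ ν * struveL ν x -
      4 * ν ^ 2 / ((2 * ν - 1) * (1 - β)) * (Real.exp (-(β * x)) * x ^ (ν - 1) * struveL ν x) -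
      gammaCorrection β ν x) := by
  rw [lowerBound₂, gammaCorrection, Real.rpow_sub_one hx.ne']
  ring

theorem lowerBound₂_lt {β ν x : ℝ} (hβ0 : 0 < β) (hβ1 : β < 1) (hν : 3 / 2 ≤ ν) (hx : 0 < x) :
    lowerBound₂ β ν x < struveIntegral β ν x := by
  obtain ⟨μ, rfl⟩ : ∃ μ, ν = μ + 1 := ⟨ν - 1, by ring⟩
  have hν1 : -1 < μ + 1 := by linarith
  rw [lowerBound₂_eq _ _ hx]
  set c := 4 * (μ + 1) ^ 2 / ((2 * (μ + 1) - 1) * (1 - β)) with hc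
  have hβ : 0 < 1 - β := by linarith
  have hμ : 0 < 2 * (μ + 1) - 1 := by linarith
  have hc0 : 0 ≤ c := by positivity
  have hc1 : 2 * (μ + 1) ≤ c * (1 - β) := by
    have : c * (1 - β) = 4 * (μ + 1) ^ 2 / (2 * (μ + 1) - 1) := by rw [hc]; field_simp
    rw [this, le_div_iff₀ hμ]
    nlinarith
  have hG : ∀ y, 0 < y → HasDerivAt (fun y => (1 - β) * struveIntegral β (μ + 1) y -
      (Real.exp (-(β * y)) * y ^ (μ + 1) * struveL (μ + 1) y -
        c * (Real.exp (-(β * y)) * y ^ (μ + 1 - 1) * struveL (μ + 1) y) -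
        gammaCorrection β (μ + 1) y))
      (Real.exp (-(β * y)) * y ^ (μ + 1 - 1) *
        (y * (struveL (μ + 1) y - struveL (μ + 1 + 1) y) +
          c * (struveL μ y - (1 + 1 / y) * struveL (μ + 1) y) +
          (c * (1 - β) - 2 * (μ + 1)) * struveL (μ + 1) y)) y := fun y hy => by
    refine (((hasDerivAt_struveIntegral β hν1 hy).const_mul (1 - β)).sub
      (((hasDerivAt_exp_mul_rpow_mul_struveL β (μ + 1) hν1 hy).sub
        ((hasDerivAt_exp_mul_rpow_mul_struveL_add_one β (μ + 1 - 1)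
          (show -1 < μ by linarith) hy).const_mul c)).sub
        (hasDerivAt_gammaCorrection hβ0 (by linarith) hy))).congr_deriv ?_
    rw [show y ^ (μ + 1) = y ^ (μ + 1 - 1) * y by rw [← Real.rpow_add_one hy.ne']; ring_nf]
    field_simp
    ring
  have h := pos_of_hasDerivAt_pos hG (fun y hy => ?_)
    (tendsto_exp_mul_rpow_mul_struveL β (p := μ + 1) hν1 (by linarith)) (fun y hy => ?_) hx
  · rw [one_div_mul_eq_div, div_lt_iff₀' hβ]
    linarith
  · have h1 := struveL_add_one_lt (show -(1 / 2) ≤ μ + 1 by linarith) hy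
    have h2 := one_add_inv_mul_struveL_add_one_lt (show 1 / 2 ≤ μ by linarith) hy
    have h3 : 0 < Real.exp (-(β * y)) * y ^ (μ + 1 - 1) := by positivity
    have h4 := mul_pos hy (sub_pos.2 h1)
    have h5 := mul_nonneg hc0 (sub_nonneg.2 h2.le)
    have h6 := mul_nonneg (sub_nonneg.2 hc1) (struveL_pos hν1 hy).le
    exact mul_pos h3 (by linarith)
  · have h1 := mul_nonneg hβ.le (struveIntegral_nonneg β hν1 hy)
    have h2 := gammaCorrection_nonneg hβ0 (show -(1 / 2) < μ + 1 by linarith) hy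
    have h3 := struveL_pos hν1 hy
    have h4 : 0 ≤ c * (Real.exp (-(β * y)) * y ^ (μ + 1 - 1) * struveL (μ + 1) y) := by positivity
    linarith

/-- The derivatives of the terms of the third bound telescope. -/
theorem sum_deriv_terms_le {β ν x : ℝ} (hβ : 0 < β) (hν : -1 < ν) (hx : 0 < x) (N : ℕ) :
    ∑ k ∈ Finset.range (N + 1), β ^ k *
      (struveL (ν + (k : ℝ)) x + ((ν - (ν + (k : ℝ)) - 1) / x - β) * struveL (ν + (k : ℝ) + 1) x)
    ≤ struveL ν x - 1 / x * struveL (ν + 1) x - β ^ (N + 1) * struveL (ν + (N : ℝ) + 1) x := by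
  induction N with
  | zero =>
    simp only [zero_add, Finset.sum_range_one, Nat.cast_zero, add_zero, pow_zero, pow_one, one_mul]
    rw [sub_self]
    exact le_of_eq (by ring)
  | succ N ih =>
    rw [Finset.sum_range_succ]
    refine (add_le_add_left ih _).trans ?_
    have hN : (0 : ℝ) ≤ N := N.cast_nonneg
    have hL := struveL_pos (show -1 < ν + ((N + 1 : ℕ) : ℝ) + 1 by push_cast; linarith) hx
    have h1 : 0 ≤ β ^ (N + 1) * ((((N + 1 : ℕ) : ℝ) + 1) / x *
        struveL (ν + ((N + 1 : ℕ) : ℝ) + 1) x) := by positivity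
    rw [show ν + (N : ℝ) + 1 = ν + ((N + 1 : ℕ) : ℝ) by push_cast; ring]
    rw [show (ν - (ν + ((N + 1 : ℕ) : ℝ)) - 1) / x = -((((N + 1 : ℕ) : ℝ) + 1) / x) by ring,
      pow_succ β (N + 1)]
    linarith

/-- All partial sums of the third bound stay below the integral, with a margin that does not depend
on the number of terms; this gives both the convergence of the series and the strict inequality. -/
theorem sum_add_lt_struveIntegral {β ν x : ℝ} (hβ : 0 < β) (hν : -1 < ν) (hx : 0 < x) (N : ℕ) :
    Real.exp (-(β * x)) * x ^ ν * ∑ k ∈ Finset.range (N + 1), β ^ k * struveL (ν + (k : ℝ) + 1) x +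
      Real.exp (-(β * x)) * x ^ (ν - 1) * struveL (ν + 1 + 1) x < struveIntegral β ν x := by
  have hνk : ∀ k : ℕ, -1 < ν + (k : ℝ) := fun k => by
    have hk : (0 : ℝ) ≤ k := k.cast_nonneg
    linarith
  have hνk1 : ∀ k : ℕ, -1 < ν + (k : ℝ) + 1 := fun k => by linarith [hνk k]
  have hG : ∀ y, 0 < y → HasDerivAt (fun y => struveIntegral β ν y -
      (∑ k ∈ Finset.range (N + 1),
        β ^ k * (Real.exp (-(β * y)) * y ^ ν * struveL (ν + (k : ℝ) + 1) y) +
        Real.exp (-(β * y)) * y ^ (ν - 1) * struveL (ν + 1 + 1) y)) _ y := fun y hy =>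
    (hasDerivAt_struveIntegral β hν hy).sub ((HasDerivAt.fun_sum fun k _ =>
      (hasDerivAt_exp_mul_rpow_mul_struveL_add_one β ν (hνk k) hy).const_mul (β ^ k)).add
      (hasDerivAt_exp_mul_rpow_mul_struveL_add_one β (ν - 1) (show -1 < ν + 1 by linarith) hy))
  have hρ : Tendsto (fun y => ∑ k ∈ Finset.range (N + 1),
        β ^ k * (Real.exp (-(β * y)) * y ^ ν * struveL (ν + (k : ℝ) + 1) y) +
        Real.exp (-(β * y)) * y ^ (ν - 1) * struveL (ν + 1 + 1) y) (𝓝[>] 0) (𝓝 0) := by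
    have h1 := tendsto_finsetSum (Finset.range (N + 1)) fun k _ =>
      (tendsto_exp_mul_rpow_mul_struveL β (p := ν) (hνk1 k)
        (by linarith [hνk1 k, (k.cast_nonneg : (0 : ℝ) ≤ k)])).const_mul (β ^ k)
    simpa using h1.add (tendsto_exp_mul_rpow_mul_struveL β (p := ν - 1)
      (show -1 < ν + 1 + 1 by linarith) (by linarith))
  have h := pos_of_hasDerivAt_pos hG (fun y hy => ?_) hρ (fun y hy => ?_) hx
  · rw [Finset.mul_sum]
    refine lt_of_sub_pos (h.trans_eq ?_)
    congr 2
    exact Finset.sum_congr rfl fun k _ => by ring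
  · have h1 := sum_deriv_terms_le hβ hν hy N
    have hE : 0 < Real.exp (-(β * y)) * y ^ (ν - 1) := by positivity
    have h2 := mul_pos (pow_pos hβ (N + 1)) (struveL_pos (hνk1 N) hy)
    have h3 := struveL_pos (show -1 < ν + 1 + 1 by linarith) hy
    have h4 : 0 < (3 / y + β) * struveL (ν + 1 + 1) y := by positivity
    have h5 : y ^ ν = y ^ (ν - 1) * y := by rw [← Real.rpow_add_one hy.ne']; ring_nf
    have h6 : ∑ k ∈ Finset.range (N + 1), β ^ k * (Real.exp (-(β * y)) * y ^ ν *
        (struveL (ν + (k : ℝ)) y +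
          ((ν - (ν + (k : ℝ)) - 1) / y - β) * struveL (ν + (k : ℝ) + 1) y)) ≤
        Real.exp (-(β * y)) * y ^ ν * (struveL ν y - 1 / y * struveL (ν + 1) y -
          β ^ (N + 1) * struveL (ν + (N : ℝ) + 1) y) := by
      refine le_trans (le_of_eq ?_) (mul_le_mul_of_nonneg_left h1
        (by positivity : 0 ≤ Real.exp (-(β * y)) * y ^ ν))
      rw [Finset.mul_sum]
      exact Finset.sum_congr rfl fun k _ => by ring
    have h7 : Real.exp (-(β * y)) * y ^ ν * (1 / y * struveL (ν + 1) y) =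
        Real.exp (-(β * y)) * y ^ (ν - 1) * struveL (ν + 1) y := by
      rw [h5]; field_simp
    have h8 : (ν - 1 - (ν + 1) - 1) / y - β = -(3 / y + β) := by ring
    rw [h8]
    have h9 := mul_pos hE h4
    have h10 := mul_pos (by positivity : 0 < Real.exp (-(β * y)) * y ^ ν) h2
    linarith
  · have h1 := struveIntegral_nonneg β hν hy
    linarith

theorem summable_pow_mul_struveL {β ν x : ℝ} (hβ : 0 < β) (hν : -1 < ν) (hx : 0 < x) :
    Summable fun k : ℕ => β ^ k * struveL (ν + (k : ℝ) + 1) x := by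
  have hL : ∀ k : ℕ, 0 < struveL (ν + (k : ℝ) + 1) x := fun k =>
    struveL_pos (by linarith [(k.cast_nonneg : (0 : ℝ) ≤ k)]) hx
  have hE : 0 < Real.exp (-(β * x)) * x ^ ν := by positivity
  refine summable_of_sum_range_le
    (c := struveIntegral β ν x / (Real.exp (-(β * x)) * x ^ ν))
    (fun k => (mul_pos (pow_pos hβ k) (hL k)).le) fun N => ?_
  have h1 := sum_add_lt_struveIntegral hβ hν hx N
  have h2 := struveL_pos (show -1 < ν + 1 + 1 by linarith) hx
  have h3 : 0 < Real.exp (-(β * x)) * x ^ (ν - 1) * struveL (ν + 1 + 1) x := by positivity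
  rw [Finset.sum_range_succ, mul_add] at h1
  have h4 := mul_pos hE (mul_pos (pow_pos hβ N) (hL N))
  rw [le_div_iff₀' hE]
  linarith

theorem lowerBound₃_lt {β ν x : ℝ} (hβ : 0 < β) (hν : -1 < ν) (hx : 0 < x) :
    lowerBound₃ β ν x < struveIntegral β ν x := by
  have hlim := ((((summable_pow_mul_struveL hβ hν hx).hasSum.tendsto_sum_nat.comp
    (tendsto_add_atTop_nat 1)).const_mul (Real.exp (-(β * x)) * x ^ ν)).add_const
    (Real.exp (-(β * x)) * x ^ (ν - 1) * struveL (ν + 1 + 1) x))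
  have h := le_of_tendsto hlim
    (Eventually.of_forall fun N => (sum_add_lt_struveIntegral hβ hν hx N).le)
  have h2 := struveL_pos (show -1 < ν + 1 + 1 by linarith) hx
  have h3 : 0 < Real.exp (-(β * x)) * x ^ (ν - 1) * struveL (ν + 1 + 1) x := by positivity
  unfold lowerBound₃
  linarith

theorem struveIntegral_pos {β ν x : ℝ} (hβ : 0 < β) (hν : -1 < ν) (hx : 0 < x) :
    0 < struveIntegral β ν x := by
  have h := sum_add_lt_struveIntegral hβ hν hx 0
  have h1 := struveL_pos (show -1 < ν + 1 + 1 by linarith) hx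
  have h2 := struveL_pos (show -1 < ν + 1 by linarith) hx
  simp only [zero_add, Finset.sum_range_one, pow_zero, Nat.cast_zero, add_zero, one_mul] at h
  refine lt_trans ?_ h
  positivity

/-! ### Behaviour at infinity -/

theorem eventually_le_mul_of_deriv_le {f g f' g' : ℝ → ℝ} {m m' : ℝ}
    (hf : ∀ᶠ x in atTop, HasDerivAt f (f' x) x) (hg : ∀ᶠ x in atTop, HasDerivAt g (g' x) x)
    (hle : ∀ᶠ x in atTop, f' x ≤ m * g' x) (hgtop : Tendsto g atTop atTop) (hm : m < m') :
    ∀ᶠ x in atTop, f x ≤ m' * g x := by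
  obtain ⟨X, hX⟩ := eventually_atTop.1 (hf.and (hg.and hle))
  have hd : ∀ x, X ≤ x → HasDerivAt (fun y => f y - m * g y) (f' x - m * g' x) x :=
    fun x hx => (hX x hx).1.sub ((hX x hx).2.1.const_mul m)
  have hanti : AntitoneOn (fun y => f y - m * g y) (Set.Ici X) := by
    refine antitoneOn_of_deriv_nonpos (convex_Ici X)
      (fun x hx => (hd x hx).continuousAt.continuousWithinAt)
      (fun x hx => ?_) (fun x hx => ?_) <;> rw [interior_Ici] at hx
    · exact (hd x (le_of_lt hx)).differentiableAt.differentiableWithinAt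
    · rw [(hd x (le_of_lt hx)).deriv]
      linarith [(hX x (le_of_lt hx)).2.2]
  filter_upwards [eventually_ge_atTop X,
    (hgtop.const_mul_atTop (sub_pos.2 hm)).eventually_ge_atTop (f X - m * g X)] with x hx hx'
  have := hanti (Set.self_mem_Ici) hx hx
  simp only at this
  linarith

/-- L'Hôpital's rule for a denominator that tends to infinity. -/
theorem lhopital_atTop_of_tendsto_atTop {f g f' g' : ℝ → ℝ} {l : ℝ}
    (hf : ∀ᶠ x in atTop, HasDerivAt f (f' x) x) (hg : ∀ᶠ x in atTop, HasDerivAt g (g' x) x)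
    (hg' : ∀ᶠ x in atTop, 0 < g' x) (hgtop : Tendsto g atTop atTop)
    (hl : Tendsto (fun x => f' x / g' x) atTop (𝓝 l)) :
    Tendsto (fun x => f x / g x) atTop (𝓝 l) := by
  refine tendsto_order.2 ⟨fun a ha => ?_, fun a ha => ?_⟩
  · obtain ⟨m, hm1, hm2⟩ := exists_between ha
    obtain ⟨m', hm'1, hm'2⟩ := exists_between hm1
    have hle : ∀ᶠ x in atTop, -f' x ≤ -m * g' x := by
      filter_upwards [hl.eventually_const_lt hm2, hg'] with x h1 h2
      have := (lt_div_iff₀ h2).1 h1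
      linarith
    filter_upwards [eventually_le_mul_of_deriv_le (f := fun x => -f x) (m' := -m')
      (hf.mono fun x hx => hx.neg) hg hle hgtop (by linarith),
      hgtop.eventually_gt_atTop 0] with x h1 h2
    refine hm'1.trans_le ((le_div_iff₀ h2).2 ?_)
    linarith
  · obtain ⟨m, hm1, hm2⟩ := exists_between ha
    obtain ⟨m', hm'1, hm'2⟩ := exists_between hm2
    have hle : ∀ᶠ x in atTop, f' x ≤ m * g' x := by
      filter_upwards [hl.eventually_lt_const hm1, hg'] with x h1 h2
      exact ((div_lt_iff₀ h2).1 h1).le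
    filter_upwards [eventually_le_mul_of_deriv_le hf hg hle hgtop hm'1,
      hgtop.eventually_gt_atTop 0] with x h1 h2
    exact ((div_le_iff₀ h2).2 h1).trans_lt hm'2

theorem struveCoeff_mul_rpow_le {ν x : ℝ} (hν : -1 < ν) (hx : 0 < x) :
    struveCoeff ν * x ^ ν ≤ 1 / x * struveL ν x := by
  rw [← inv_mul_struveTerm_zero hx]
  gcongr
  exact (summable_struveTerm hν hx).le_tsum 0 fun k _ => (struveTerm_pos hν hx k).le

theorem tendsto_struveCoeff_mul_rpow_div {ν : ℝ} (hν : -1 < ν) :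
    Tendsto (fun x => struveCoeff ν * x ^ ν / struveL ν x) atTop (𝓝 0) := by
  have h0 : Tendsto (fun x : ℝ => 1 / x) atTop (𝓝 0) := by
    simpa using tendsto_inv_atTop_zero (𝕜 := ℝ)
  refine tendsto_of_tendsto_of_tendsto_of_le_of_le' tendsto_const_nhds h0 ?_ ?_ <;>
    filter_upwards [eventually_gt_atTop 0] with x hx
  · have := struveL_pos hν hx
    have := struveCoeff_pos hν
    positivity
  · exact (div_le_iff₀ (struveL_pos hν hx)).2 (struveCoeff_mul_rpow_le hν hx)

theorem tendsto_exp_mul_struveL_atTop {ν : ℝ} (hν : -1 < ν) :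
    Tendsto (fun x => Real.exp x * struveL ν x) atTop atTop := by
  have h := (tendsto_exp_mul_div_rpow_atTop (-(ν + 1)) 1 one_pos).const_mul_atTop
    (struveCoeff_pos hν)
  refine tendsto_atTop_mono' _ ?_ h
  filter_upwards [eventually_gt_atTop 0] with x hx
  have h1 := struveCoeff_mul_rpow_le hν hx
  rw [one_div_mul_eq_div, le_div_iff₀ hx] at h1
  rw [Real.rpow_neg hx.le, div_inv_eq_mul, Real.rpow_add_one hx.ne', one_mul]
  calc _ = Real.exp x * (struveCoeff ν * x ^ ν * x) := by ring
    _ ≤ _ := by gcongr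

/-- With `u = 𝐋_{ν+1}` and `v = 𝐋_ν`, the differential equations make `e^x (v - u)` grow slower than
`e^x (v + u)`, so that `u / v → 1`. -/
theorem tendsto_struveL_add_one_div {ν : ℝ} (hν : -1 < ν) :
    Tendsto (fun x => struveL (ν + 1) x / struveL ν x) atTop (𝓝 1) := by
  have hν' : -1 < ν + 1 := by linarith
  have h0 : Tendsto (fun x : ℝ => 1 / x) atTop (𝓝 0) := by
    simpa using tendsto_inv_atTop_zero (𝕜 := ℝ)
  have hv : ∀ x, 0 < x → HasDerivAt (fun y => Real.exp y * struveL ν y)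
      (Real.exp x * (struveL (ν + 1) x + struveCoeff ν * x ^ ν + (ν / x + 1) * struveL ν x)) x :=
    fun x hx => ((Real.hasDerivAt_exp x).mul (hasDerivAt_struveL hν hx)).congr_deriv (by ring)
  have hu : ∀ x, 0 < x → HasDerivAt (fun y => Real.exp y * struveL (ν + 1) y)
      (Real.exp x * (struveL ν x + (1 - (ν + 1) / x) * struveL (ν + 1) x)) x :=
    fun x hx => ((Real.hasDerivAt_exp x).mul (hasDerivAt_struveL_add_one hν hx)).congr_deriv
      (by ring)
  have hS : ∀ x, 0 < x → 0 < struveL ν x + struveL (ν + 1) x := fun x hx =>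
    add_pos (struveL_pos hν hx) (struveL_pos hν' hx)
  -- the terms of the derivatives that are negligible against `v + u`
  have hr : Tendsto (fun x => struveCoeff ν * x ^ ν / (struveL ν x + struveL (ν + 1) x))
      atTop (𝓝 0) := by
    refine tendsto_of_tendsto_of_tendsto_of_le_of_le' tendsto_const_nhds
      (tendsto_struveCoeff_mul_rpow_div hν) ?_ ?_ <;>
      filter_upwards [eventually_gt_atTop 0] with x hx
    · have := hS x hx
      have := struveCoeff_pos hν
      positivity
    · have := struveL_pos hν hx
      have := struveL_pos hν' hx
      have := struveCoeff_pos hν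
      gcongr
      linarith
  have hp : Tendsto (fun x => struveL ν x / (struveL ν x + struveL (ν + 1) x) * (1 / x))
      atTop (𝓝 0) := by
    refine tendsto_of_tendsto_of_tendsto_of_le_of_le' tendsto_const_nhds h0 ?_ ?_ <;>
      filter_upwards [eventually_gt_atTop 0] with x hx
    · have := hS x hx
      have := struveL_pos hν hx
      positivity
    · have := struveL_pos hν' hx
      exact mul_le_of_le_one_left (by positivity) ((div_le_one (hS x hx)).2 (by linarith))
  have hq : Tendsto (fun x => struveL (ν + 1) x / (struveL ν x + struveL (ν + 1) x) * (1 / x))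
      atTop (𝓝 0) := by
    refine tendsto_of_tendsto_of_tendsto_of_le_of_le' tendsto_const_nhds h0 ?_ ?_ <;>
      filter_upwards [eventually_gt_atTop 0] with x hx
    · have := hS x hx
      have := struveL_pos hν' hx
      positivity
    · have := struveL_pos hν hx
      exact mul_le_of_le_one_left (by positivity) ((div_le_one (hS x hx)).2 (by linarith))
  have hnum := (hr.add (hp.const_mul ν)).add (hq.const_mul (ν + 1))
  have hden := ((hr.add (hp.const_mul ν)).sub (hq.const_mul (ν + 1))).const_add 2
  norm_num only [mul_zero, add_zero, sub_zero] at hnum hden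
  have hdiff : ∀ x, 0 < x → HasDerivAt
      (fun y => Real.exp y * struveL ν y - Real.exp y * struveL (ν + 1) y)
      (Real.exp x * (struveL ν x + struveL (ν + 1) x) *
        (struveCoeff ν * x ^ ν / (struveL ν x + struveL (ν + 1) x) +
          ν * (struveL ν x / (struveL ν x + struveL (ν + 1) x) * (1 / x)) +
          (ν + 1) * (struveL (ν + 1) x / (struveL ν x + struveL (ν + 1) x) * (1 / x)))) x :=
    fun x hx => ((hv x hx).sub (hu x hx)).congr_deriv (by
      have := (hS x hx).ne'
      field_simp
      ring)
  have hsum : ∀ x, 0 < x → HasDerivAt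
      (fun y => Real.exp y * struveL ν y + Real.exp y * struveL (ν + 1) y)
      (Real.exp x * (struveL ν x + struveL (ν + 1) x) *
        (2 + (struveCoeff ν * x ^ ν / (struveL ν x + struveL (ν + 1) x) +
          ν * (struveL ν x / (struveL ν x + struveL (ν + 1) x) * (1 / x)) -
          (ν + 1) * (struveL (ν + 1) x / (struveL ν x + struveL (ν + 1) x) * (1 / x))))) x :=
    fun x hx => ((hv x hx).add (hu x hx)).congr_deriv (by
      have := (hS x hx).ne'
      field_simp
      ring)
  have hlim : Tendsto (fun x => (Real.exp x * struveL ν x - Real.exp x * struveL (ν + 1) x) /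
      (Real.exp x * struveL ν x + Real.exp x * struveL (ν + 1) x)) atTop (𝓝 0) := by
    refine lhopital_atTop_of_tendsto_atTop ((eventually_gt_atTop 0).mono hdiff)
      ((eventually_gt_atTop 0).mono hsum) ?_ ?_ ?_
    · filter_upwards [eventually_gt_atTop 0, hden.eventually_const_lt two_pos] with x hx h
      exact mul_pos (mul_pos (Real.exp_pos x) (hS x hx)) h
    · exact (tendsto_exp_mul_struveL_atTop hν).atTop_add_atTop (tendsto_exp_mul_struveL_atTop hν')
    · have h := hnum.div hden two_ne_zero
      rw [zero_div] at h
      refine h.congr' ?_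
      filter_upwards [eventually_gt_atTop 0] with x hx
      exact (mul_div_mul_left _ _ (mul_pos (Real.exp_pos x) (hS x hx)).ne').symm
  have h := (hlim.const_sub 1).div (hlim.const_add 1) (by norm_num)
  norm_num only [add_zero, sub_zero, div_one] at h
  refine h.congr' ?_
  filter_upwards [eventually_gt_atTop 0] with x hx
  have h1 := struveL_pos hν hx
  have h2 := struveL_pos hν' hx
  have h3 := Real.exp_pos x
  have h4 := (hS x hx).ne'
  simp only [Pi.div_apply]
  rw [← mul_sub, ← mul_add, mul_div_mul_left _ _ h3.ne']
  rw [one_sub_div h4, one_add_div h4, div_div_div_cancel_right₀ h4]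
  have h5 : struveL ν x + struveL (ν + 1) x + (struveL ν x - struveL (ν + 1) x) ≠ 0 := by linarith
  rw [div_eq_div_iff h5 h1.ne']
  ring

/-- The factor by which differentiation multiplies `e^{-bx} x^p 𝐋_ν(x)`. -/
theorem tendsto_logDeriv_struveL (b p : ℝ) {ν : ℝ} (hν : -1 < ν) :
    Tendsto (fun x => struveL (ν + 1) x / struveL ν x + struveCoeff ν * x ^ ν / struveL ν x +
      ((ν + p) / x - b)) atTop (𝓝 (1 - b)) := by
  have h := ((tendsto_struveL_add_one_div hν).add (tendsto_struveCoeff_mul_rpow_div hν)).add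
    (((tendsto_id (α := ℝ)).const_div_atTop (ν + p)).sub_const b)
  simpa [sub_eq_add_neg] using h

theorem hasDerivAt_exp_mul_rpow_mul_struveL' (b p : ℝ) {ν x : ℝ} (hν : -1 < ν) (hx : 0 < x) :
    HasDerivAt (fun y => Real.exp (-(b * y)) * y ^ p * struveL ν y)
      (Real.exp (-(b * x)) * x ^ p * struveL ν x *
        (struveL (ν + 1) x / struveL ν x + struveCoeff ν * x ^ ν / struveL ν x +
          ((ν + p) / x - b))) x := by
  refine (hasDerivAt_exp_mul_rpow_mul_struveL b p hν hx).congr_deriv ?_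
  have := (struveL_pos hν hx).ne'
  field_simp

theorem tendsto_exp_mul_rpow_mul_struveL_atTop {b : ℝ} (hb : b < 1) (p : ℝ) {ν : ℝ}
    (hν : -1 < ν) :
    Tendsto (fun x => Real.exp (-(b * x)) * x ^ p * struveL ν x) atTop atTop := by
  obtain ⟨c, hbc, hc⟩ := exists_between hb
  -- for `b < c < 1` the function with `c` in place of `b` is still eventually increasing
  obtain ⟨X, hX⟩ := eventually_atTop.1 ((eventually_gt_atTop (0 : ℝ)).and
    ((tendsto_logDeriv_struveL c p hν).eventually_const_lt (sub_pos.2 hc)))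
  have hX0 : 0 < X := (hX X le_rfl).1
  have hmono : MonotoneOn (fun x => Real.exp (-(c * x)) * x ^ p * struveL ν x) (Set.Ici X) := by
    refine monotoneOn_of_deriv_nonneg (convex_Ici X) (fun x hx =>
      (hasDerivAt_exp_mul_rpow_mul_struveL' c p hν
        (hX x hx).1).continuousAt.continuousWithinAt) (fun x hx => ?_) (fun x hx => ?_) <;>
      rw [interior_Ici] at hx <;> have hx1 := hX x (le_of_lt hx)
    · exact (hasDerivAt_exp_mul_rpow_mul_struveL' c p hν
        hx1.1).differentiableAt.differentiableWithinAt
    · rw [(hasDerivAt_exp_mul_rpow_mul_struveL' c p hν hx1.1).deriv]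
      have h1 := hx1.1
      have h2 := struveL_pos hν h1
      exact mul_nonneg (by positivity) hx1.2.le
  have hC : 0 < Real.exp (-(c * X)) * X ^ p * struveL ν X := by
    have := struveL_pos hν hX0
    positivity
  refine tendsto_atTop_mono' _ ?_ ((Real.tendsto_exp_atTop.comp
    (tendsto_id.const_mul_atTop (sub_pos.2 hbc))).atTop_mul_const hC)
  filter_upwards [eventually_ge_atTop X] with x hx
  have h := hmono Set.self_mem_Ici hx hx
  simp only [Function.comp, id]
  calc _ ≤ Real.exp ((c - b) * x) * (Real.exp (-(c * x)) * x ^ p * struveL ν x) := by gcongr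
    _ = _ := by
      rw [← mul_assoc, ← mul_assoc, ← Real.exp_add]
      ring_nf

theorem tendsto_exp_mul_rpow_mul_struveL_div_struveIntegral {β ν : ℝ} (hβ : β < 1) (hν : -1 < ν) :
    Tendsto (fun x => Real.exp (-(β * x)) * x ^ ν * struveL ν x / struveIntegral β ν x) atTop
      (𝓝 (1 - β)) := by
  have hβ' : 1 - β ≠ 0 := by linarith
  have hlog := tendsto_logDeriv_struveL β ν hν
  have h : Tendsto (fun x => struveIntegral β ν x /
      (Real.exp (-(β * x)) * x ^ ν * struveL ν x)) atTop (𝓝 (1 - β)⁻¹) := by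
    refine lhopital_atTop_of_tendsto_atTop
      ((eventually_gt_atTop 0).mono fun x hx => hasDerivAt_struveIntegral β hν hx)
      ((eventually_gt_atTop 0).mono fun x hx => hasDerivAt_exp_mul_rpow_mul_struveL' β ν hν hx)
      ?_ (tendsto_exp_mul_rpow_mul_struveL_atTop hβ ν hν) ?_
    · filter_upwards [eventually_gt_atTop 0, hlog.eventually_const_lt (sub_pos.2 hβ)] with x hx h
      have := struveL_pos hν hx
      positivity
    · refine (hlog.inv₀ hβ').congr' ?_
      filter_upwards [eventually_gt_atTop 0] with x hx
      have h1 := struveL_pos hν hx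
      have h2 : 0 < Real.exp (-(β * x)) * x ^ ν * struveL ν x := by positivity
      rw [div_mul_cancel_left₀ h2.ne']
  simpa using h.inv₀ (inv_ne_zero hβ')

theorem tendsto_struveIntegral_atTop {β ν : ℝ} (hβ : β < 1) (hν : -1 < ν) :
    Tendsto (struveIntegral β ν) atTop atTop := by
  have h := (tendsto_exp_mul_rpow_mul_struveL_div_struveIntegral hβ hν).inv₀
    (sub_pos.2 hβ).ne'
  refine (h.pos_mul_atTop (inv_pos.2 (sub_pos.2 hβ))
    (tendsto_exp_mul_rpow_mul_struveL_atTop hβ ν hν)).congr' ?_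
  filter_upwards [eventually_gt_atTop 0] with x hx
  have h1 := struveL_pos hν hx
  have h2 : Real.exp (-(β * x)) * x ^ ν * struveL ν x ≠ 0 := by positivity
  rw [inv_div, div_mul_cancel₀ _ h2]

/-! ### Tightness of the bounds -/

theorem tendsto_gammaCorrection_div_struveIntegral {β ν : ℝ} (hβ0 : 0 < β) (hβ1 : β < 1)
    (hν : -(1 / 2) < ν) :
    Tendsto (fun x => gammaCorrection β ν x / struveIntegral β ν x) atTop (𝓝 0) := by
  have hν1 : -1 < ν := by linarith
  refine tendsto_of_tendsto_of_tendsto_of_le_of_le' tendsto_const_nhds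
    ((tendsto_struveIntegral_atTop hβ1 hν1).const_div_atTop (Real.Gamma (2 * ν + 1) /
      (√Real.pi * (2 : ℝ) ^ ν * β ^ (2 * ν + 1) * Real.Gamma (ν + 3 / 2)))) ?_ ?_ <;>
    filter_upwards [eventually_gt_atTop 0] with x hx
  · exact div_nonneg (gammaCorrection_nonneg hβ0 hν hx) (struveIntegral_nonneg β hν1 hx)
  · exact div_le_div_of_nonneg_right (gammaCorrection_le hβ0 hν hx)
      (struveIntegral_nonneg β hν1 hx)

theorem tendsto_lowerBound₁_div {β ν : ℝ} (hβ0 : 0 < β) (hβ1 : β < 1) (hν : -(1 / 2) < ν) :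
    Tendsto (fun x => lowerBound₁ β ν x / struveIntegral β ν x) atTop (𝓝 1) := by
  have h := ((tendsto_exp_mul_rpow_mul_struveL_div_struveIntegral hβ1
    (show -1 < ν by linarith)).sub
    (tendsto_gammaCorrection_div_struveIntegral hβ0 hβ1 hν)).const_mul (1 / (1 - β))
  rw [sub_zero, one_div_mul_cancel (sub_pos.2 hβ1).ne'] at h
  refine h.congr fun x => ?_
  rw [lowerBound₁, gammaCorrection]
  ring

theorem tendsto_lowerBound₂_div {β ν : ℝ} (hβ0 : 0 < β) (hβ1 : β < 1) (hν : -(1 / 2) < ν) :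
    Tendsto (fun x => lowerBound₂ β ν x / struveIntegral β ν x) atTop (𝓝 1) := by
  have h0 : Tendsto (fun x : ℝ => 1 / x) atTop (𝓝 0) := by
    simpa using tendsto_inv_atTop_zero (𝕜 := ℝ)
  have hc := (h0.const_mul (4 * ν ^ 2 / ((2 * ν - 1) * (1 - β)))).const_sub 1
  have h := ((hc.mul (tendsto_exp_mul_rpow_mul_struveL_div_struveIntegral hβ1
    (show -1 < ν by linarith))).sub
    (tendsto_gammaCorrection_div_struveIntegral hβ0 hβ1 hν)).const_mul (1 / (1 - β))
  rw [mul_zero, sub_zero, sub_zero, one_mul, one_div_mul_cancel (sub_pos.2 hβ1).ne'] at h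
  refine h.congr fun x => ?_
  rw [lowerBound₂, gammaCorrection]
  ring

theorem tendsto_struveL_add_nat_div {ν : ℝ} (hν : -1 < ν) (k : ℕ) :
    Tendsto (fun x => struveL (ν + (k : ℝ) + 1) x / struveL ν x) atTop (𝓝 1) := by
  induction k with
  | zero => simpa using tendsto_struveL_add_one_div hν
  | succ k ih =>
    have hk : (0 : ℝ) ≤ k := k.cast_nonneg
    have hk1 : -1 < ν + (k : ℝ) + 1 := by linarith
    have h := (tendsto_struveL_add_one_div hk1).mul ih
    rw [one_mul] at h
    refine h.congr' ?_
    filter_upwards [eventually_gt_atTop 0] with x hx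
    rw [div_mul_div_cancel₀ (struveL_pos hk1 hx).ne']
    push_cast
    ring_nf

/-- The first `N` terms of the third bound already capture the proportion `1 - β ^ N` of the
integral. -/
theorem tendsto_partialSum_div_struveIntegral {β ν : ℝ} (hβ : β < 1) (hν : -1 < ν) (N : ℕ) :
    Tendsto (fun x => Real.exp (-(β * x)) * x ^ ν *
      (∑ k ∈ Finset.range N, β ^ k * struveL (ν + (k : ℝ) + 1) x) / struveIntegral β ν x) atTop
      (𝓝 (1 - β ^ N)) := by
  have h := (tendsto_exp_mul_rpow_mul_struveL_div_struveIntegral hβ hν).mul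
    (tendsto_finsetSum (Finset.range N) fun k _ =>
      (tendsto_struveL_add_nat_div hν k).const_mul (β ^ k))
  simp only [mul_one] at h
  rw [mul_neg_geom_sum] at h
  refine h.congr' ?_
  filter_upwards [eventually_gt_atTop 0] with x hx
  have h1 := (struveL_pos hν hx).ne'
  simp_rw [← mul_div_assoc, ← Finset.sum_div]
  field_simp

theorem tendsto_lowerBound₃_div {β ν : ℝ} (hβ0 : 0 < β) (hβ1 : β < 1) (hν : -1 < ν) :
    Tendsto (fun x => lowerBound₃ β ν x / struveIntegral β ν x) atTop (𝓝 1) := by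
  refine tendsto_order.2 ⟨fun a ha => ?_, fun a ha => ?_⟩
  · obtain ⟨N, hN⟩ := exists_pow_lt_of_lt_one (sub_pos.2 ha) hβ1
    filter_upwards [eventually_gt_atTop 0, (tendsto_partialSum_div_struveIntegral hβ1 hν
      N).eventually_const_lt (show a < 1 - β ^ N by linarith)] with x hx h
    refine h.trans_le (div_le_div_of_nonneg_right ?_ (struveIntegral_nonneg β hν hx))
    unfold lowerBound₃
    gcongr
    refine (summable_pow_mul_struveL hβ0 hν hx).sum_le_tsum _ fun k _ => ?_
    have hk : (0 : ℝ) ≤ k := k.cast_nonneg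
    have := struveL_pos (show -1 < ν + (k : ℝ) + 1 by linarith) hx
    positivity
  · filter_upwards [eventually_gt_atTop 0] with x hx
    exact ((div_lt_one (struveIntegral_pos hβ0 hν hx)).2 (lowerBound₃_lt hβ0 hν hx)).trans ha

/-- Lower bounds for `F(x) = ∫_0^x e^{-βt} t^ν 𝐋_ν(t) dt`, each of them tight as `x → ∞`, that is,
the quotient of the bound by `F(x)` tends to `1`. The integral and the series in the third bound
converge. -/
theorem theorem1 (β : ℝ) (hβ0 : 0 < β) (hβ1 : β < 1) :
    (∀ ν : ℝ, -1 < ν → ∀ x : ℝ, 0 < x →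
      IntervalIntegrable (fun t : ℝ => Real.exp (-(β * t)) * t ^ ν * struveL ν t) volume 0 x ∧
      Summable (fun k : ℕ => β ^ k * struveL (ν + (k : ℝ) + 1) x)) ∧
    (∀ ν : ℝ, -(1 / 2) < ν → ν ≤ 0 →
      (∀ x : ℝ, 0 < x → lowerBound₁ β ν x < struveIntegral β ν x) ∧
      Tendsto (fun x : ℝ => lowerBound₁ β ν x / struveIntegral β ν x) atTop (𝓝 1)) ∧
    (∀ ν : ℝ, 3 / 2 ≤ ν →
      (∀ x : ℝ, 0 < x → lowerBound₂ β ν x < struveIntegral β ν x) ∧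
      Tendsto (fun x : ℝ => lowerBound₂ β ν x / struveIntegral β ν x) atTop (𝓝 1)) ∧
    (∀ ν : ℝ, -1 < ν →
      (∀ x : ℝ, 0 < x → lowerBound₃ β ν x < struveIntegral β ν x) ∧
      Tendsto (fun x : ℝ => lowerBound₃ β ν x / struveIntegral β ν x) atTop (𝓝 1)) := by
  refine ⟨fun ν hν x hx => ⟨intervalIntegrable_struve β hν hx,
    summable_pow_mul_struveL hβ0 hν hx⟩,
    fun ν hν hν0 => ⟨fun x hx => lowerBound₁_lt hβ0 hβ1 hν hν0 hx,
      tendsto_lowerBound₁_div hβ0 hβ1 hν⟩,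
    fun ν hν => ⟨fun x hx => lowerBound₂_lt hβ0 hβ1 hν hx,
      tendsto_lowerBound₂_div hβ0 hβ1 (by linarith)⟩,
    fun ν hν => ⟨fun x hx => lowerBound₃_lt hβ0 hν hx, tendsto_lowerBound₃_div hβ0 hβ1 hν⟩⟩
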